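/- Let $p$ be a prime number, let $F$ be a field of characteristic $p$ (for instance a global field of characteristic $p$), and let $d \ge 1$ be an integer. Let $H \subset \mathrm{GL}_d(F)$ be a finite subgroup that is a $p$-group, and let $\chi : H \to \mathbb{Z}^\times = \{\pm 1\}$ be a character. For $s \ge 0$, let $H_s(H, \chi)$ denote the $s$-th group homology of $H$ with coefficients in the abelian group $\mathbb{Z}$ on which $h \in H$ acts as multiplication by $\chi(h)$. Then for every integer $s \ge 1$ the group $H_s(H, \chi)$ is killed by $$p^{\max(0,\,1+s(d-2))}.$$ In particular, it is killed by $p^{1+s(d-2)}$ if $d \ge 2$, and it is zero if $d = 1$. -/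

import Mathlib

universe u

/-- For a character `χ : G → ℤˣ`, the representation of `G` on the rank-one free module over `R`
on which `g` acts as multiplication by the integer `χ g = ±1`. -/
def characterRepresentation (R : Type u) [CommRing R] {G : Type u} [Group G] (χ : G →* ℤˣ) :
    Representation R G R where
  toFun g := LinearMap.mulLeft R (((χ g : ℤˣ) : ℤ) : R)
  map_one' := by ext; simp
  map_mul' g h := by ext; simp

/-- The group homology `H_s(G, χ)` of `G` with coefficients in the integers, `G` acting through
`χ : G → ℤˣ`. Mathlib's `groupHomology` wants the coefficient ring and the group in one universe,
so the ring of integers is taken in the universe of `G`. -/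
noncomputable abbrev characterHomology {G : Type u} [Group G] (χ : G →* ℤˣ) (s : ℕ) :
    ModuleCat.{u} (ULift.{u} ℤ) :=
  groupHomology (Rep.of (characterRepresentation (ULift.{u} ℤ) χ)) s

-- Induct on the dimension. A finite `p`-group `G` acting linearly in characteristic `p` fixes a
-- nonzero vector `v`. The subgroup `S` acting trivially modulo `v` consists of maps `w ↦ w + c •
-- v`, so it is commutative of exponent dividing `p`, and `G ⧸ S` is faithful in one dimension less
-- (`exists_faithful_quotient`).
--
-- Two facts carry the induction. Positive-degree homology of `S` with coefficients in a character
-- is killed by a single `p`, whatever the rank (`isKilledBy_prime_of_pow_eq_one`). If `n` kills the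
-- homology of `S` in degrees `1, …, s` and `N` kills `H_s(G ⧸ S, A_S)`, then `n ^ s * N` kills
-- `H_s(G, A)` (`IsKilledBy.of_normal`). So each extra dimension costs `p ^ s`, starting from `p` in
-- dimension 2, where `G = S`. If the character is nontrivial on `S`, then `p = 2` and `A_S` is
-- itself killed by 2.
--
-- The spectral sequence is replaced by dimension shifting along `functions A ⟶ A`, whose source is
-- acyclic for `G`, has acyclic restriction to `S`, and has coinvariants acyclic for `G ⧸ S`.

universe v

/-! ### Annihilators of homology and long exact sequences -/

namespace groupHomology

open CategoryTheory Rep Finsupp Representation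

variable {k G : Type u} [CommRing k] [Group G]

theorem map_g_eq_zero_iff {X : ShortComplex (Rep k G)} (hX : X.ShortExact) (i : ℕ)
    (x : groupHomology X.X₂ i) (hx : map (MonoidHom.id G) X.g i x = 0) :
    ∃ y : groupHomology X.X₁ i, map (MonoidHom.id G) X.f i y = x :=
  (ShortComplex.moduleCat_exact_iff _).1 (mapShortComplex₂_exact hX i) x hx

theorem exists_δ_eq {X : ShortComplex (Rep k G)} (hX : X.ShortExact) (i : ℕ)
    (x : groupHomology X.X₁ i) (hx : map (MonoidHom.id G) X.f i x = 0) :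
    ∃ y : groupHomology X.X₃ (i + 1), δ hX (i + 1) i rfl y = x :=
  (ShortComplex.moduleCat_exact_iff _).1 (mapShortComplex₁_exact hX rfl) x hx

theorem δ_injective {X : ShortComplex (Rep k G)} (hX : X.ShortExact) (i : ℕ)
    (h : Limits.IsZero (groupHomology X.X₂ (i + 1))) :
    Function.Injective (δ hX (i + 1) i rfl) :=
  (ModuleCat.mono_iff_injective _).1 (mono_δ_of_isZero hX i h)

theorem δ_surjective {X : ShortComplex (Rep k G)} (hX : X.ShortExact) (i : ℕ)
    (h : Limits.IsZero (groupHomology X.X₂ i)) :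
    Function.Surjective (δ hX (i + 1) i rfl) :=
  (ModuleCat.epi_iff_surjective _).1 (epi_δ_of_isZero hX i h)

/-- The homology `H_i(G, A)` is annihilated by the natural number `n`. -/
def IsKilledBy (A : Rep k G) (i n : ℕ) : Prop := ∀ x : groupHomology A i, n • x = 0

theorem IsKilledBy.of_dvd {A : Rep k G} {i m n : ℕ} (h : IsKilledBy A i m) (hmn : m ∣ n) :
    IsKilledBy A i n := by
  obtain ⟨c, rfl⟩ := hmn
  intro x
  rw [mul_comm, mul_smul, h x, smul_zero]

theorem isKilledBy_of_isZero {A : Rep k G} {i : ℕ} (h : Limits.IsZero (groupHomology A i))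
    (n : ℕ) : IsKilledBy A i n := fun x => by
  have := ModuleCat.subsingleton_of_isZero h
  exact Subsingleton.elim _ _

theorem IsKilledBy.X₁_of_X₃ {X : ShortComplex (Rep k G)} (hX : X.ShortExact) {i n : ℕ}
    (h : Limits.IsZero (groupHomology X.X₂ i)) (h₃ : IsKilledBy X.X₃ (i + 1) n) :
    IsKilledBy X.X₁ i n := fun x => by
  obtain ⟨y, rfl⟩ := δ_surjective hX i h x
  rw [← map_nsmul, h₃ y, map_zero]

theorem IsKilledBy.X₃_of_X₁ {X : ShortComplex (Rep k G)} (hX : X.ShortExact) {i n : ℕ}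
    (h : Limits.IsZero (groupHomology X.X₂ (i + 1))) (h₁ : IsKilledBy X.X₁ i n) :
    IsKilledBy X.X₃ (i + 1) n := fun x => by
  apply δ_injective hX i h
  rw [map_nsmul, h₁, map_zero]

theorem IsKilledBy.X₂_of_X₁_of_X₃ {X : ShortComplex (Rep k G)} (hX : X.ShortExact) {i m n : ℕ}
    (h₁ : IsKilledBy X.X₁ i m) (h₃ : IsKilledBy X.X₃ i n) :
    IsKilledBy X.X₂ i (m * n) := fun x => by
  obtain ⟨y, hy⟩ := map_g_eq_zero_iff hX i (n • x) (by rw [map_nsmul, h₃])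
  rw [mul_smul, ← hy, ← map_nsmul, h₁ y, map_zero]

theorem isKilledBy_of_forall_smul_eq_zero {A : Rep k G} {n : ℕ} (h : ∀ a : A, n • a = 0) (i : ℕ) :
    IsKilledBy A i n := fun x => by
  induction x using groupHomology_induction_on with | h z =>
  have : n • z = 0 := by
    apply (ModuleCat.mono_iff_injective (iCycles A i)).1 inferInstance
    rw [map_nsmul, map_zero]
    exact Finsupp.ext fun g => h _
  rw [← map_nsmul, this, map_zero]

theorem map_nsmul_hom {H : Type u} [Group H] {A : Rep k G} {B : Rep k H} (f : G →* H)
    (φ ψ : A ⟶ res f B) (n : ℕ) (hψ : ∀ a, ψ.hom a = n • φ.hom a) (i : ℕ)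
    (x : groupHomology A i) : map f ψ i x = n • map f φ i x := by
  have : chainsMap f ψ = n • chainsMap f φ := by
    ext j g a
    simp [hψ]
  have h := (HomologicalComplex.homologyFunctor (ModuleCat k) (ComplexShape.down ℕ) i).map_nsmul
    (f := chainsMap f φ) (n := n)
  rw [← this] at h
  exact congr($h x)

end groupHomology

/-! ### Acyclicity of weakly projective representations -/

theorem Fin.contractNth_zero_cons {α : Type*} {n : ℕ} (op : α → α → α) (a : α)
    (g : Fin (n + 1) → α) :
    Fin.contractNth 0 op (Fin.cons a g : Fin (n + 2) → α) =
      Fin.cons (op a (g 0)) fun i => g i.succ := by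
  funext i
  cases i using Fin.cases with
  | zero => rw [Fin.contractNth_apply_of_eq _ _ _ _ rfl]; simp
  | succ i => rw [Fin.contractNth_apply_of_gt _ _ _ _ (by simp)]; simp

theorem Fin.contractNth_succ_cons {α : Type*} {n : ℕ} (op : α → α → α) (j : Fin (n + 1)) (a : α)
    (g : Fin (n + 1) → α) :
    Fin.contractNth j.succ op (Fin.cons a g : Fin (n + 2) → α) =
      Fin.cons a (Fin.contractNth j op g) := by
  funext i
  cases i using Fin.cases with
  | zero => rw [Fin.contractNth_apply_of_lt _ _ _ _ (by simp)]; simp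
  | succ i =>
    rcases lt_trichotomy (i : ℕ) j with h | h | h
    · rw [Fin.contractNth_apply_of_lt _ _ _ _ (by simpa), Fin.cons_succ,
        Fin.contractNth_apply_of_lt _ _ _ _ h, ← Fin.succ_castSucc, Fin.cons_succ]
    · rw [Fin.contractNth_apply_of_eq _ _ _ _ (by simpa), Fin.cons_succ,
        Fin.cons_succ, Fin.contractNth_apply_of_eq _ _ _ _ h, ← Fin.succ_castSucc, Fin.cons_succ]
    · rw [Fin.contractNth_apply_of_gt _ _ _ _ (by simpa), Fin.cons_succ,
        Fin.cons_succ, Fin.contractNth_apply_of_gt _ _ _ _ h]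

namespace Rep

open CategoryTheory Finsupp

variable {k G : Type u} [CommRing k] [Group G]

/-- A representation `A` of a finite group `G` is weakly projective if the identity of `A` is the
trace `∑ g, g ∘ f ∘ g⁻¹` of some linear endomorphism `f` of `A`. -/
def IsWeaklyProjective [Fintype G] (A : Rep k G) : Prop :=
  ∃ f : A →ₗ[k] A, ∀ a, ∑ g, A.ρ g (f (A.ρ g⁻¹ a)) = a

theorem IsWeaklyProjective.isZero_groupHomology [Fintype G] {A : Rep k G}
    (hA : A.IsWeaklyProjective) (n : ℕ) : Limits.IsZero (groupHomology A (n + 1)) := by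
  obtain ⟨f, hf⟩ := hA
  -- A contracting homotopy in positive degrees: prepend every `c` and apply `f ∘ c`. The zeroth
  -- face gives back the trace of `f`; the other faces cancel against `h ∘ d`.
  let h (n : ℕ) : ((Fin n → G) →₀ A) →ₗ[k] ((Fin (n + 1) → G) →₀ A) :=
    lsum (R := k) k fun g => ∑ c : G, lsingle (Fin.cons c g) ∘ₗ f ∘ₗ A.ρ c
  have h_single (n : ℕ) (g : Fin n → G) (a : A) :
      h n (single g a) = ∑ c, single (Fin.cons c g) (f (A.ρ c a)) := by
    simp [h]
  have key (n : ℕ) (x : (Fin (n + 1) → G) →₀ A) :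
      groupHomology.inhomogeneousChains.d A (n + 1) (h (n + 1) x) +
        h n (groupHomology.inhomogeneousChains.d A n x) = x := by
    induction x using Finsupp.induction_linear with
    | zero => simp
    | add x y hx hy =>
      simp only [map_add]
      rw [add_add_add_comm, hx, hy]
    | single g a =>
      have h1 : ∑ c, A.ρ c⁻¹ (f (A.ρ c a)) = a := by
        rw [← Equiv.sum_comp (Equiv.inv G)]
        simpa using hf a
      have h2 : ∑ c, single (Fin.cons (c * g 0) fun i : Fin n => g i.succ : Fin (n + 1) → G)
          (f (A.ρ c a)) = ∑ c, single (Fin.cons c fun i : Fin n => g i.succ : Fin (n + 1) → G)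
          (f (A.ρ c (A.ρ (g 0)⁻¹ a))) := by
        symm
        rw [← Equiv.sum_comp (Equiv.mulRight (g 0))]
        refine Finset.sum_congr rfl fun c _ => ?_
        simp
      have hd (c : G) (b : A) : groupHomology.inhomogeneousChains.d A (n + 1)
          (single (Fin.cons c g) b) = single g (A.ρ c⁻¹ b) +
            (-single (Fin.cons (c * g 0) fun i => g i.succ) b -
              ∑ j : Fin (n + 1), (-1 : k) ^ ((j : ℕ) + 1) •
                single (Fin.cons c (Fin.contractNth j (· * ·) g)) b) := by
        rw [groupHomology.inhomogeneousChains.d_single, Fin.sum_univ_succ]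
        simp [Fin.contractNth_zero_cons, Fin.contractNth_succ_cons, pow_succ]
      rw [h_single, (map_sum (groupHomology.inhomogeneousChains.d A (n + 1)).hom _ _).trans
        (Finset.sum_congr rfl fun c _ => hd c _), groupHomology.inhomogeneousChains.d_single,
        map_add, h_single, map_sum, Finset.sum_add_distrib, Finset.sum_sub_distrib,
        Finset.sum_neg_distrib, h2, ← single_finsetSum, h1, Finset.sum_comm]
      simp only [map_smul, h_single, Finset.smul_sum]
      abel
  rw [groupHomology, ← HomologicalComplex.exactAt_iff_isZero_homology,
    HomologicalComplex.exactAt_iff' _ (n + 2) (n + 1) n (by simp) (by simp),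
    ShortComplex.moduleCat_exact_iff]
  intro x hx
  refine ⟨h (n + 1) x, ?_⟩
  have h3 := key n x
  have h4 : groupHomology.inhomogeneousChains.d A n x = 0 := by
    rw [← groupHomology.inhomogeneousChains.d_def]; exact hx
  rw [h4, map_zero, add_zero, ← groupHomology.inhomogeneousChains.d_def] at h3
  exact h3

end Rep

/-! ### Weak projectivity under restriction and coinvariants; dimension shifting -/

namespace Subgroup

theorem bijective_quotient_out_mul {G : Type*} [Group G] (S : Subgroup G) :
    Function.Bijective fun x : (G ⧸ S) × S => x.1.out * (x.2 : G) := by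
  constructor
  · rintro ⟨q, s⟩ ⟨r, t⟩ h
    have hq : q = r := by
      have := congrArg (QuotientGroup.mk (s := S)) h
      simpa using this
    subst hq
    simpa using h
  · intro g
    refine ⟨(g, ⟨(g : G ⧸ S).out⁻¹ * g, ?_⟩), by simp⟩
    rw [← QuotientGroup.eq]
    simp

theorem sum_eq_sum_quotient_sum {G M : Type*} [Group G] [Fintype G] [AddCommMonoid M]
    (S : Subgroup G) [Fintype S] [Fintype (G ⧸ S)] (φ : G → M) :
    ∑ g, φ g = ∑ q : G ⧸ S, ∑ s : S, φ (q.out * s) := by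
  rw [← (Equiv.ofBijective _ S.bijective_quotient_out_mul).sum_comp, Fintype.sum_prod_type]
  rfl

end Subgroup

namespace Rep

open CategoryTheory Finsupp Representation

variable {k G : Type u} [CommRing k] [Group G]

/-- Grouping the `G`-trace of `f` by left cosets of `S` makes it the `S`-trace of `∑ q, q⁻¹ ∘ f ∘
q`. -/
theorem IsWeaklyProjective.res [Fintype G] {A : Rep.{u} k G} (hA : A.IsWeaklyProjective)
    (S : Subgroup G) [Fintype S] : (res S.subtype A).IsWeaklyProjective := by
  classical
  obtain ⟨f, hf⟩ := hA
  refine ⟨∑ q : G ⧸ S, A.ρ q.out⁻¹ ∘ₗ f ∘ₗ A.ρ q.out, fun a => ?_⟩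
  have h := hf a
  rw [← Equiv.sum_comp (Equiv.inv G), S.sum_eq_sum_quotient_sum, Finset.sum_comm,
    ← Equiv.sum_comp (Equiv.inv S)] at h
  refine Eq.trans ?_ h
  refine Finset.sum_congr rfl fun s _ => ?_
  simp [LinearMap.sum_apply]

theorem IsWeaklyProjective.quotientToCoinvariants [Fintype G] {A : Rep.{u} k G}
    (hA : A.IsWeaklyProjective) (S : Subgroup G) [S.Normal] [Fintype (G ⧸ S)] :
    (quotientToCoinvariants A S).IsWeaklyProjective := by
  classical
  obtain ⟨f, hf⟩ := hA
  have mk_conj (g : G) (s : S) (a : A) : Coinvariants.mk (A.ρ.comp S.subtype) (A.ρ (g * s) a) =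
      Coinvariants.mk (A.ρ.comp S.subtype) (A.ρ g a) := by
    have h := Coinvariants.mk_self_apply (A.ρ.comp S.subtype)
      ⟨g * s * g⁻¹, Subgroup.Normal.conj_mem ‹_› s.1 s.2 g⟩ (A.ρ g a)
    rw [← h]
    simp
  -- Summing `f ∘ s` over `S` makes the map descend to coinvariants; its trace over `G ⧸ S` recovers
  -- the full trace of `f` over `G`.
  refine ⟨Coinvariants.lift _ (Coinvariants.mk _ ∘ₗ ∑ s : S, f ∘ₗ A.ρ s) fun s => ?_, fun x => ?_⟩
  · ext a
    simp only [LinearMap.comp_apply, LinearMap.sum_apply]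
    symm
    rw [← Equiv.sum_comp (Equiv.mulRight s)]
    simp
  · induction x using Coinvariants.induction_on with | h a =>
    conv_rhs => rw [← hf a, S.sum_eq_sum_quotient_sum, map_sum]
    refine Finset.sum_congr rfl fun q _ => ?_
    have hq : q = QuotientGroup.mk q.out := by simp
    conv_lhs => rw [hq, ← QuotientGroup.mk_inv]
    change Coinvariants.mk _ (A.ρ q.out ((∑ s : S, f ∘ₗ A.ρ s) (A.ρ q.out⁻¹ a))) = _
    rw [← Equiv.sum_comp (Equiv.inv S), LinearMap.sum_apply, map_sum, map_sum, map_sum]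
    refine Finset.sum_congr rfl fun s _ => ?_
    rw [mk_conj]
    simp

/-- The representation of `G` on the functions `G → A` by left translation. -/
noncomputable abbrev functions (A : Rep.{u} k G) : Rep.{u} k G :=
  Rep.of (X := G → A)
    { toFun g := LinearMap.funLeft k A (g⁻¹ * ·)
      map_one' := by ext; simp
      map_mul' g h := by ext; simp [LinearMap.funLeft_apply, mul_assoc] }

theorem isWeaklyProjective_functions [Fintype G] (A : Rep.{u} k G) :
    (functions A).IsWeaklyProjective := by
  classical
  refine ⟨LinearMap.single k (fun _ : G => (A : Type u)) 1 ∘ₗ LinearMap.proj 1, fun φ => ?_⟩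
  refine funext fun x => ?_
  refine (Finset.sum_apply x Finset.univ _).trans ?_
  rw [Finset.sum_eq_single x]
  · simp
  · intro g _ hg
    simp [inv_mul_eq_one, hg]
  · simp

/-- The morphism from the functions `G → A` to `A` sending `φ` to `∑ x, x • φ x`. -/
noncomputable def functionsSum [Fintype G] (A : Rep.{u} k G) : functions A ⟶ A :=
  Rep.ofHom (ρ := (functions A).ρ) (σ := A.ρ)
    { toLinearMap := ∑ x : G, A.ρ x ∘ₗ LinearMap.proj (R := k) (φ := fun _ : G => (A : Type u)) x
      isIntertwining' := fun g => by
        refine LinearMap.ext fun φ => ?_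
        simp only [LinearMap.comp_apply, LinearMap.sum_apply, map_sum]
        rw [← Equiv.sum_comp (Equiv.mulLeft g)]
        refine Finset.sum_congr rfl fun x _ => ?_
        change A.ρ (g * x) (φ (g⁻¹ * (g * x))) = A.ρ g (A.ρ x (φ x))
        simp }

theorem functionsSum_apply [Fintype G] (A : Rep.{u} k G) (φ : G → A) :
    (functionsSum A).hom φ = ∑ x : G, A.ρ x (φ x) := by
  change (∑ x : G, A.ρ x ∘ₗ LinearMap.proj (R := k) (φ := fun _ : G => (A : Type u)) x) φ = _
  simp [LinearMap.sum_apply]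

theorem functionsSum_surjective [Fintype G] (A : Rep.{u} k G) :
    Function.Surjective (functionsSum A).hom := fun a => by
  classical
  refine ⟨(Pi.single 1 a : G → A), ?_⟩
  rw [functionsSum_apply, Finset.sum_eq_single 1]
  · simp
  · intro x _ hx
    simp [hx]
  · simp

/-- The kernel of a morphism of representations. -/
noncomputable abbrev kernel {A B : Rep.{u} k G} (φ : A ⟶ B) : Rep.{u} k G :=
  Rep.of (A.ρ.subrepresentation (LinearMap.ker φ.hom.toLinearMap) fun g a ha => by
    have : φ.hom a = 0 := ha
    change φ.hom (A.ρ g a) = 0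
    rw [hom_comm_apply, this, map_zero])

/-- The inclusion of the kernel of a morphism of representations. -/
noncomputable abbrev kernelι {A B : Rep.{u} k G} (φ : A ⟶ B) : kernel φ ⟶ A :=
  Rep.ofHom (σ := A.ρ) ⟨Submodule.subtype _, fun _ => rfl⟩

/-- The factorization of a morphism through a kernel. -/
noncomputable abbrev kernelLift {A B C : Rep.{u} k G} (φ : A ⟶ B) (ψ : C ⟶ A)
    (h : ∀ c, φ.hom (ψ.hom c) = 0) : C ⟶ kernel φ :=
  Rep.ofHom (ρ := C.ρ) ⟨ψ.hom.toLinearMap.codRestrict _ h, fun g => by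
    ext c
    exact hom_comm_apply ψ g c⟩

theorem shortExact_of_injective_of_surjective {X : ShortComplex (Rep.{u} k G)}
    (hf : Function.Injective X.f.hom) (hg : Function.Surjective X.g.hom)
    (h : ∀ x, X.g.hom x = 0 → ∃ y, X.f.hom y = x) : X.ShortExact where
  exact := (forget₂ (Rep.{u} k G) (ModuleCat k)).reflects_exact_of_faithful _ <|
    (ShortComplex.moduleCat_exact_iff _).2 h
  mono_f := (Rep.mono_iff_injective _).2 hf
  epi_g := (Rep.epi_iff_surjective _).2 hg

/-- The short complex `kernel φ ⟶ A ⟶ B` attached to `φ : A ⟶ B`. -/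
@[simps]
noncomputable def kernelShortComplex {A B : Rep.{u} k G} (φ : A ⟶ B) : ShortComplex (Rep.{u} k G) where
  X₁ := kernel φ
  X₂ := A
  X₃ := B
  f := kernelι φ
  g := φ
  zero := by
    ext x
    exact x.2

theorem kernelShortComplex_shortExact {A B : Rep.{u} k G} (φ : A ⟶ B)
    (hφ : Function.Surjective φ.hom) : (kernelShortComplex φ).ShortExact :=
  shortExact_of_injective_of_surjective Subtype.val_injective hφ fun x hx => ⟨⟨x, hx⟩, rfl⟩

/-- The short complex `kernel φ ⟶ A ⟶ kernel ψ` attached to a complex `A ⟶ B ⟶ C` of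
representations. -/
@[simps]
noncomputable def kernelKernelShortComplex {A B C : Rep.{u} k G} (φ : A ⟶ B) (ψ : B ⟶ C)
    (h : ∀ a, ψ.hom (φ.hom a) = 0) : ShortComplex (Rep.{u} k G) where
  X₁ := kernel φ
  X₂ := A
  X₃ := kernel ψ
  f := kernelι φ
  g := kernelLift ψ φ h
  zero := by
    ext x
    exact x.2

theorem kernelKernelShortComplex_shortExact {A B C : Rep.{u} k G} (φ : A ⟶ B) (ψ : B ⟶ C)
    (h : ∀ a, ψ.hom (φ.hom a) = 0) (hφψ : ∀ b, ψ.hom b = 0 → ∃ a, φ.hom a = b) :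
    (kernelKernelShortComplex φ ψ h).ShortExact :=
  shortExact_of_injective_of_surjective Subtype.val_injective
    (fun ⟨b, hb⟩ => (hφψ b hb).imp fun _ ha => Subtype.ext ha)
    fun x hx => ⟨⟨x, congrArg Subtype.val hx⟩, rfl⟩

end Rep

/-! ### Annihilators for an extension by a normal subgroup -/

namespace groupHomology

open CategoryTheory Rep Finsupp Representation

variable {k G : Type u} [CommRing k] [Group G]

/-- The factor `m` comes from `ker φ`, and `n` from `A / ker φ ≅ ker ψ`, whose homology is a
quotient of that of `C` one degree up. -/
theorem IsKilledBy.of_rightExact {A B C : Rep.{u} k G} (φ : A ⟶ B) (ψ : B ⟶ C)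
    (h : ∀ a, ψ.hom (φ.hom a) = 0) (hφψ : ∀ b, ψ.hom b = 0 → ∃ a, φ.hom a = b)
    (hψ : Function.Surjective ψ.hom) {i m n : ℕ} (hB : Limits.IsZero (groupHomology B i))
    (hker : ∀ a, φ.hom a = 0 → m • a = 0) (hC : IsKilledBy C (i + 1) n) :
    IsKilledBy A i (m * n) :=
  IsKilledBy.X₂_of_X₁_of_X₃ (kernelKernelShortComplex_shortExact φ ψ h hφψ)
    (isKilledBy_of_forall_smul_eq_zero (A := kernel φ)
      (fun a => Subtype.ext (hker a.1 a.2)) i)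
    (IsKilledBy.X₁_of_X₃ (kernelShortComplex_shortExact ψ hψ) hB hC)

/-- Such a `z` comes from `H₁` of `X.X₃` under the connecting map. -/
theorem smul_eq_zero_of_coinvariantsMap_eq_zero {X : ShortComplex (Rep.{u} k G)}
    (hX : X.ShortExact) {n : ℕ} (h : IsKilledBy X.X₃ 1 n)
    (z : (coinvariantsFunctor k G).obj X.X₁) (hz : (coinvariantsFunctor k G).map X.f z = 0) :
    n • z = 0 := by
  obtain ⟨y, hy⟩ := exists_δ_eq hX 0 ((H0Iso X.X₁).inv z) (by
    have h1 := congr($(map_id_comp_H0Iso_hom X.f) ((H0Iso X.X₁).inv z))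
    simp only [ModuleCat.comp_apply, Iso.inv_hom_id_apply] at h1
    apply ((H0Iso X.X₂).toLinearEquiv).injective
    rw [map_zero]
    exact h1.trans hz)
  have h2 : n • (H0Iso X.X₁).inv z = 0 := by rw [← hy, ← map_nsmul, h y, map_zero]
  rw [← map_nsmul] at h2
  have h3 := congrArg (H0Iso X.X₁).hom h2
  simpa using h3

theorem coinvariantsFunctor_map_exact {X : ShortComplex (Rep.{u} k G)}
    (hX : X.ShortExact) (z : (coinvariantsFunctor k G).obj X.X₂)
    (hz : (coinvariantsFunctor k G).map X.g z = 0) :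
    ∃ y, (coinvariantsFunctor k G).map X.f y = z := by
  have h := hX.exact
  have := hX.epi_g
  have h1 := h.map_of_epi_of_preservesCokernel (coinvariantsFunctor k G) inferInstance
    inferInstance
  exact (ShortComplex.moduleCat_exact_iff _).1 h1 z hz

theorem IsKilledBy.one_of_normal (S : Subgroup G) [S.Normal] {n N : ℕ} {A : Rep.{u} k G}
    (hS : IsKilledBy (res S.subtype A) 1 n) (hA : IsKilledBy (quotientToCoinvariants A S) 1 N) :
    IsKilledBy A 1 (n * N) := fun x => by
  obtain ⟨y, hy⟩ := (ShortComplex.moduleCat_exact_iff _).1 (H1CoresCoinf_exact A S) (N • x)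
    ((map_nsmul (H1CoresCoinf A S).g.hom N x).trans (hA _))
  have h := map_nsmul (H1CoresCoinf A S).f.hom n y
  rw [mul_smul]
  exact (congrArg (n • ·) hy).symm.trans (h.symm.trans
    ((congrArg (H1CoresCoinf A S).f.hom (hS y)).trans (map_zero (H1CoresCoinf A S).f.hom)))

/-- The consequence for annihilators of the Lyndon–Hochschild–Serre spectral sequence. -/
theorem IsKilledBy.of_normal [Finite G] (S : Subgroup G) [S.Normal] {n N : ℕ} (s : ℕ)
    (A : Rep.{u} k G) (hS : ∀ j ≤ s, IsKilledBy (res S.subtype A) (j + 1) n)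
    (hA : IsKilledBy (quotientToCoinvariants A S) (s + 1) N) :
    IsKilledBy A (s + 1) (n ^ (s + 1) * N) := by
  have := Fintype.ofFinite G
  have := Fintype.ofFinite S
  have := Fintype.ofFinite (G ⧸ S)
  induction s generalizing A N with
  | zero =>
    simpa using IsKilledBy.one_of_normal S (hS 0 le_rfl) hA
  | succ s ih =>
    have hP := isWeaklyProjective_functions A
    have hX := kernelShortComplex_shortExact _ (functionsSum_surjective A)
    have hXS := (shortExact_res S.subtype).2 hX
    refine IsKilledBy.X₃_of_X₁ hX (hP.isZero_groupHomology _) ?_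
    -- One factor `n` joins `N`: `n * N` kills the homology of the coinvariants of the kernel, `n`
    -- accounting for the `H₁(S, A)` that obstructs left exactness of coinvariants.
    rw [pow_succ, mul_assoc]
    refine ih (kernel (functionsSum A)) (fun j hj => ?_) ?_
    · exact IsKilledBy.X₁_of_X₃ hXS ((hP.res S).isZero_groupHomology j) (hS (j + 1) (by lia))
    · refine IsKilledBy.of_rightExact
        ((quotientToCoinvariantsFunctor k S).map (kernelι (functionsSum A)))
        ((quotientToCoinvariantsFunctor k S).map (functionsSum A)) (fun a => ?_)
        (coinvariantsFunctor_map_exact hXS) (fun b => ?_)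
        ((hP.quotientToCoinvariants S).isZero_groupHomology s)
        (smul_eq_zero_of_coinvariantsMap_eq_zero hXS (hS 0 (by lia))) hA
      · induction a using Coinvariants.induction_on with | h a =>
        exact congrArg (Coinvariants.mk (A.ρ.comp S.subtype)) a.2
      · induction b using Coinvariants.induction_on with | h b =>
        obtain ⟨c, rfl⟩ := functionsSum_surjective A b
        exact ⟨Coinvariants.mk _ c, rfl⟩

end groupHomology

/-! ### Sums over a normal subgroup acting on homology -/

namespace groupHomology

open CategoryTheory Rep Finsupp Representation

variable {k G : Type u} [CommRing k] [Group G]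

/-- The sum over a normal subgroup `C`, as a morphism from `A` to its restriction along an
endomorphism `e` of `G` which is the identity modulo `C`. -/
noncomputable def sumNormal (C : Subgroup G) [C.Normal] [Fintype C] (e : G →* G)
    (he : ∀ g, (e g)⁻¹ * g ∈ C) (A : Rep.{u} k G) : A ⟶ res e A :=
  Rep.ofHom (ρ := A.ρ) (σ := A.ρ.comp e)
    { toLinearMap := ∑ c : C, A.ρ c
      isIntertwining' := fun g => by
        ext a
        simp only [LinearMap.comp_apply, LinearMap.sum_apply, map_sum, MonoidHom.comp_apply]
        -- The bijection `c ↦ (e g)⁻¹ * c * g`, so that `e g * σ c = c * g`.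
        let σ : C ≃ C := (MulAut.conjNormal (e g)⁻¹).toEquiv.trans
          (Equiv.mulRight ⟨(e g)⁻¹ * g, he g⟩)
        symm
        rw [← Equiv.sum_comp σ]
        refine Finset.sum_congr rfl fun c _ => ?_
        rw [← Module.End.mul_apply, ← Module.End.mul_apply, ← map_mul, ← map_mul]
        simp [σ, mul_assoc] }

theorem sumNormal_apply (C : Subgroup G) [C.Normal] [Fintype C] (e : G →* G)
    (he : ∀ g, (e g)⁻¹ * g ∈ C) (A : Rep.{u} k G) (a : A) :
    (sumNormal C e he A).hom a = ∑ c : C, A.ρ c a := by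
  change (∑ c : C, A.ρ c) a = _
  rw [LinearMap.sum_apply]

theorem sumNormal_naturality (C : Subgroup G) [C.Normal] [Fintype C] (e : G →* G)
    (he : ∀ g, (e g)⁻¹ * g ∈ C) {A B : Rep.{u} k G} (φ : A ⟶ B) :
    chainsMap e (sumNormal C e he A) ≫ chainsMap (MonoidHom.id G) φ =
      chainsMap (MonoidHom.id G) φ ≫ chainsMap e (sumNormal C e he B) := by
  rw [← chainsMap_comp, ← chainsMap_comp]
  refine chainsMap_congr rfl (LinearMap.ext fun a => ?_)
  refine (congrArg φ.hom (sumNormal_apply C e he A a)).trans ?_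
  refine Eq.trans ?_ (sumNormal_apply C e he B (φ.hom a)).symm
  rw [map_sum]
  exact Finset.sum_congr rfl fun c _ => hom_comm_apply φ c a

/-- Dimension shifting reduces this to degree 0, where each `c` acts trivially on coinvariants. -/
theorem map_sumNormal [Finite G] (C : Subgroup G) [C.Normal] [Fintype C] (e : G →* G)
    (he : ∀ g, (e g)⁻¹ * g ∈ C) (i : ℕ) (A : Rep.{u} k G) (x : groupHomology A i) :
    map e (sumNormal C e he A) i x = Nat.card C • x := by
  have := Fintype.ofFinite G
  induction i generalizing A with
  | zero =>
    induction x using H0_induction_on with | h a =>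
    have h := congr($(H0π_comp_map e (sumNormal C e he A)) a)
    refine h.trans ?_
    have h1 (b : A) : H0π A b = (H0Iso A).inv (Coinvariants.mk A.ρ b) :=
      congr($((coinvariantsMk_comp_H0Iso_inv A).symm) b)
    change H0π A ((sumNormal C e he A).hom a) = _
    rw [sumNormal_apply, map_sum]
    simp only [h1, Coinvariants.mk_self_apply]
    rw [Finset.sum_const, Finset.card_univ, Nat.card_eq_fintype_card]
  | succ i ih =>
    have hX := kernelShortComplex_shortExact _ (functionsSum_surjective A)
    let X := kernelShortComplex (functionsSum A)
    let Φ : X.map (chainsFunctor k G) ⟶ X.map (chainsFunctor k G) :=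
      { τ₁ := chainsMap e (sumNormal C e he X.X₁)
        τ₂ := chainsMap e (sumNormal C e he X.X₂)
        τ₃ := chainsMap e (sumNormal C e he X.X₃)
        comm₁₂ := sumNormal_naturality C e he X.f
        comm₂₃ := sumNormal_naturality C e he X.g }
    have h := HomologicalComplex.HomologySequence.δ_naturality Φ (map_chainsFunctor_shortExact hX)
      (map_chainsFunctor_shortExact hX) (i + 1) i rfl
    apply δ_injective hX i ((isWeaklyProjective_functions A).isZero_groupHomology i)
    refine Eq.trans ?_ (map_nsmul (δ hX (i + 1) i rfl).hom _ x).symm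
    refine Eq.trans ?_ (ih _ _)
    exact congr($h x).symm

theorem map_apply_of_factors {H K : Type u} [Group H] [Group K] {A : Rep.{u} k G}
    {B : Rep.{u} k H} {C : Rep.{u} k K} (f : G →* H) (g : H →* K) (e : G →* K) (he : g.comp f = e)
    (φ : A ⟶ res f B) (ψ : B ⟶ res g C) (χ : A ⟶ res e C)
    (h : ∀ a, χ.hom a = ψ.hom (φ.hom a)) (i : ℕ) (x : groupHomology A i) :
    map e χ i x = map g ψ i (map f φ i x) := by
  subst he
  have h1 := congr($(map_comp f g φ ψ i) x)
  refine Eq.trans ?_ h1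
  exact congr($(map_congr rfl (LinearMap.ext h) i) x)

/-- Take `C = ⊤` and `e = 1` in `map_sumNormal`: multiplication by the order of `G` then factors
through the homology of the trivial group. -/
theorem isKilledBy_card [Finite G] (i : ℕ) (A : Rep.{u} k G) :
    IsKilledBy A (i + 1) (Nat.card G) := fun x => by
  have := Fintype.ofFinite (⊤ : Subgroup G)
  have h := map_sumNormal (⊤ : Subgroup G) 1 (fun _ => Subgroup.mem_top _) (i + 1) A x
  rw [Subgroup.card_top] at h
  rw [← h]
  let B : Rep.{u} k (⊥ : Subgroup G) := res (⊥ : Subgroup G).subtype A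
  rw [map_apply_of_factors (B := B) 1 (⊥ : Subgroup G).subtype 1 rfl
    (Rep.ofHom (ρ := A.ρ) (σ := B.ρ.comp (1 : G →* (⊥ : Subgroup G)))
      (sumNormal ⊤ 1 (fun _ => Subgroup.mem_top _) A).hom) (𝟙 B)
    (sumNormal ⊤ 1 (fun _ => Subgroup.mem_top _) A) fun _ => rfl]
  have := ModuleCat.subsingleton_of_isZero (isZero_groupHomology_succ_of_subsingleton B i)
  rw [Subsingleton.elim (map _ _ (i + 1) x) 0, map_zero]

/-- If `G` is a semidirect product of a finite normal subgroup `C` acting trivially on `A` and a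
subgroup `B`, then the homology of `G` is annihilated by the order of `C` wherever the homology of
`B` is. -/
theorem IsKilledBy.of_retraction [Finite G] (C B : Subgroup G) [C.Normal] (π : G →* B)
    (hπ : ∀ g, (π g : G)⁻¹ * g ∈ C) (A : Rep.{u} k G) (hA : ∀ c ∈ C, ∀ a, A.ρ c a = a) {i : ℕ}
    (h : IsKilledBy (res B.subtype A) i (Nat.card C)) : IsKilledBy A i (Nat.card C) := fun x => by
  have := Fintype.ofFinite C
  let φ : A ⟶ res π (res B.subtype A) := Rep.ofHom (ρ := A.ρ) (σ := A.ρ.comp (B.subtype.comp π))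
    ⟨LinearMap.id, fun g => by
      ext a
      have := congrArg (A.ρ (π g)) (hA _ (hπ g) a)
      simpa [← Module.End.mul_apply, ← map_mul] using this⟩
  let ψ : A ⟶ res (B.subtype.comp π) A := φ
  -- Since `C` acts trivially, the sum over `C` is multiplication by its order. Hence `|C| • x` is
  -- the image of `|C| • π_* x`, which vanishes in the homology of `B`.
  rw [← map_sumNormal C (B.subtype.comp π) hπ i A x]
  refine (map_nsmul_hom _ ψ _ (Nat.card C) (fun a => ?_) i x).trans ?_
  · refine (sumNormal_apply C (B.subtype.comp π) hπ A a).trans ?_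
    rw [Finset.sum_congr rfl fun (c : C) _ => hA c c.2 a, Finset.sum_const, Finset.card_univ,
      Nat.card_eq_fintype_card]
    rfl
  · rw [map_apply_of_factors π B.subtype _ rfl φ (𝟙 (res B.subtype A)) ψ fun _ => rfl,
      ← map_nsmul, h, map_zero]

end groupHomology

/-! ### Commutative groups of exponent dividing a prime -/

theorem AddSubgroup.exists_retraction {V : Type*} [AddCommGroup V] (p : ℕ) [Fact p.Prime]
    [Module (ZMod p) V] (C : AddSubgroup V) :
    ∃ r : V →+ V, (∀ v, r v ∈ C) ∧ ∀ c ∈ C, r c = c := by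
  let W : Submodule (ZMod p) V := AddSubgroup.toZModSubmodule p C
  obtain ⟨r, hr⟩ := W.subtype.exists_leftInverse_of_injective W.ker_subtype
  exact ⟨(W.subtype ∘ₗ r).toAddMonoidHom, fun v => (r v).2,
    fun c hc => congrArg Subtype.val (LinearMap.congr_fun hr ⟨c, hc⟩)⟩

theorem Subgroup.exists_retraction_of_pow_prime_eq_one {G : Type*} [CommGroup G] (p : ℕ)
    [Fact p.Prime] (hG : ∀ g : G, g ^ p = 1) (C : Subgroup G) :
    ∃ r : G →* G, (∀ g, r g ∈ C) ∧ ∀ c ∈ C, r c = c := by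
  have : Module (ZMod p) (Additive G) := AddCommGroup.zmodModule fun g => hG g.toMul
  obtain ⟨r, hr, hrC⟩ := AddSubgroup.exists_retraction p C.toAddSubgroup
  exact ⟨AddMonoidHom.toMultiplicative r, fun g => hr (Additive.ofMul g),
    fun c hc => hrC (Additive.ofMul c) hc⟩

namespace groupHomology

open CategoryTheory Rep Finsupp Representation

variable {k : Type u} [CommRing k]

/-- Split off subgroups of order `p` from the kernel of `χ` without increasing the annihilator. When
none remain, `χ` is injective and `G` is trivial or of order `p = 2`. -/
theorem isKilledBy_prime_of_pow_eq_one (p : ℕ) [hp : Fact p.Prime] {G : Type u} [CommGroup G]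
    [Finite G] (hG : ∀ g : G, g ^ p = 1) (A : Rep.{u} k G) (χ : G →* ℤˣ)
    (hχ : ∀ g a, A.ρ g a = (χ g : ℤ) • a) (i : ℕ) : IsKilledBy A (i + 1) p := by
  induction h : Nat.card G using Nat.strong_induction_on generalizing G with | _ n ih =>
  subst h
  by_cases hinj : Function.Injective χ
  · refine (isKilledBy_card i A).of_dvd ?_
    rcases subsingleton_or_nontrivial G with hs | hs
    · simp
    · obtain ⟨g, hg⟩ := exists_ne (1 : G)
      have h2 : g ^ 2 = 1 := hinj (by rw [map_pow, map_one, Int.units_sq])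
      have hp2 : p ∣ 2 := orderOf_eq_prime (hG g) hg ▸ orderOf_dvd_of_pow_eq_one h2
      have hle : Nat.card G ≤ 2 := by
        simpa using Nat.card_le_card_of_injective χ hinj
      have hlt := Finite.one_lt_card (α := G)
      have := (Nat.prime_dvd_prime_iff_eq hp.out Nat.prime_two).1 hp2
      rw [this, show Nat.card G = 2 by lia]
  · rw [injective_iff_map_eq_one] at hinj
    push Not at hinj
    obtain ⟨c, hc, hc1⟩ := hinj
    let C := Subgroup.zpowers c
    have hC : Nat.card C = p := by rw [Nat.card_zpowers, orderOf_eq_prime (hG c) hc1]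
    obtain ⟨r, hr, hrC⟩ := Subgroup.exists_retraction_of_pow_prime_eq_one p hG C
    -- The projection with kernel `C` onto a complement of `C`.
    let e : G →* G := MonoidHom.id G / r
    have he (g : G) : e g = g / r g := rfl
    have hecard : Nat.card e.range < Nat.card G := by
      refine lt_of_le_of_ne e.range.card_le_card_group fun hcard => hc1 ?_
      have hsurj : Function.Surjective e :=
        MonoidHom.range_eq_top.1 (Subgroup.eq_top_of_card_eq _ hcard)
      refine Finite.injective_iff_surjective.2 hsurj ?_
      rw [he, hrC c (Subgroup.mem_zpowers c), div_self', map_one]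
    rw [← hC]
    refine IsKilledBy.of_retraction C e.range e.rangeRestrict (fun g => ?_) A (fun x hx a => ?_) ?_
    · have : (e g)⁻¹ * g = r g := by rw [he, inv_div, div_mul_cancel]
      exact this ▸ hr g
    · obtain ⟨m, rfl⟩ := hx
      simp [hχ, hc]
    · rw [hC]
      exact ih _ hecard (fun g => Subtype.ext (hG g)) (res e.range.subtype A)
        (χ.comp e.range.subtype) (fun g a => hχ g a) rfl

end groupHomology

/-! ### Linear representations of finite `p`-groups in characteristic `p` -/

theorem Representation.exists_ne_zero_fixed_of_isPGroup {F V : Type*} [Field F] (p : ℕ)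
    [hp : Fact p.Prime] [CharP F p] {G : Type*} [Group G] [Finite G] (hG : IsPGroup p G)
    [AddCommGroup V] [Module F V] [Nontrivial V] (ρ : Representation F G V) :
    ∃ v ≠ 0, ∀ g, ρ g v = v := by
  have hpV (v : V) : p • v = 0 := by
    rw [← Nat.cast_smul_eq_nsmul F, CharP.cast_eq_zero, zero_smul]
  have : Module (ZMod p) V := AddCommGroup.zmodModule hpV
  obtain ⟨v, hv⟩ := exists_ne (0 : V)
  -- Over `ZMod p`, unlike over `F`, the span of an orbit is always finite, so fixed points can be
  -- counted modulo `p`.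
  let W : Submodule (ZMod p) V := Submodule.span _ (Set.range fun g => ρ g v)
  have hW (g : G) (w : V) (hw : w ∈ W) : ρ g w ∈ W := by
    have : W ≤ W.comap ((ρ g).toAddMonoidHom.toZModLinearMap p) :=
      Submodule.span_le.2 fun _ ⟨h, hh⟩ => Submodule.subset_span ⟨g * h, by simp [← hh]⟩
    exact this hw
  have hvW : v ∈ W := Submodule.subset_span ⟨1, by simp⟩
  have : Module.Finite (ZMod p) W := Module.Finite.span_of_finite _ (Set.finite_range _)
  have : Finite W := Module.finite_of_finite (ZMod p)
  let _ : MulAction G W :=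
    { smul g w := ⟨ρ g w, hW g w w.2⟩
      one_smul w := Subtype.ext (by change ρ 1 (w : V) = w; simp)
      mul_smul g h w := Subtype.ext (by change ρ (g * h) (w : V) = ρ g (ρ h w); simp) }
  have hcard : p ∣ Nat.card W := by
    have hp0 : p • (⟨v, hvW⟩ : W) = 0 := Subtype.ext (hpV v)
    have ho := addOrderOf_eq_prime hp0 fun h0 => hv (congrArg Subtype.val h0)
    exact (dvd_of_eq ho.symm).trans (addOrderOf_dvd_natCard _)
  obtain ⟨w, hw, hw0⟩ := hG.exists_fixed_point_of_prime_dvd_card_of_fixed_point W hcard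
    (a := (0 : W)) fun g => Subtype.ext (map_zero (ρ g))
  exact ⟨w, fun h0 => hw0 (Subtype.ext h0.symm), fun g => congrArg Subtype.val (hw g)⟩

theorem QuotientGroup.lift_ker_injective {G M : Type*} [Group G] [Monoid M] (τ : G →* M) :
    Function.Injective (QuotientGroup.lift τ.ker τ le_rfl) := by
  intro a b h
  induction a using QuotientGroup.induction_on with | H a =>
  induction b using QuotientGroup.induction_on with | H b =>
  rw [QuotientGroup.eq, MonoidHom.mem_ker, map_mul]
  have h' : τ a = τ b := h
  rw [← h', ← map_mul, inv_mul_cancel, map_one]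

namespace Representation

variable {F V : Type*} [Field F] {G : Type*} [Group G] [AddCommGroup V] [Module F V]
  {ρ : Representation F G V}

theorem subsingleton_of_isPGroup_of_finrank_le_one (p : ℕ) [Fact p.Prime] [CharP F p] [Finite G] (hG : IsPGroup p G)
    [Module.Finite F V] (hV : Module.finrank F V ≤ 1) (hρ : Function.Injective ρ) :
    Subsingleton G := by
  refine ⟨fun g h => hρ ?_⟩
  rcases subsingleton_or_nontrivial V with hs | hs
  · exact LinearMap.ext fun _ => Subsingleton.elim _ _
  · obtain ⟨v, hv, hfix⟩ := exists_ne_zero_fixed_of_isPGroup p hG ρ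
    have h1 : Module.finrank F V = 1 := le_antisymm hV Module.finrank_pos
    ext w
    obtain ⟨c, rfl⟩ := exists_smul_eq_of_finrank_eq_one h1 hv w
    simp [hfix]

theorem commute_of_forall_exists_eq_add (hρ : Function.Injective ρ) {v : V} (hv : ∀ g, ρ g v = v)
    {a b : G} (ha : ∀ w, ∃ c : F, ρ a w = w + c • v) (hb : ∀ w, ∃ c : F, ρ b w = w + c • v) :
    a * b = b * a := by
  refine hρ (LinearMap.ext fun w => ?_)
  obtain ⟨c, hc⟩ := ha w
  obtain ⟨d, hd⟩ := hb w
  simp [hc, hd, hv]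
  abel

theorem pow_eq_one_of_forall_exists_eq_add (p : ℕ) [CharP F p] (hρ : Function.Injective ρ) {v : V}
    (hv : ∀ g, ρ g v = v) {a : G} (ha : ∀ w, ∃ c : F, ρ a w = w + c • v) : a ^ p = 1 := by
  refine hρ (LinearMap.ext fun w => ?_)
  obtain ⟨c, hc⟩ := ha w
  have h (n : ℕ) : ρ (a ^ n) w = w + ((n : F) * c) • v := by
    induction n with
    | zero => simp
    | succ n ih =>
      rw [pow_succ', map_mul, Module.End.mul_apply, ih, map_add, map_smul, hv, hc]
      push_cast
      module
  rw [h, CharP.cast_eq_zero]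
  simp

/-- The representation on the quotient by the line spanned by a fixed vector. -/
def quotientSpanSingleton (ρ : Representation F G V) {v : V} (hv : ∀ g, ρ g v = v) :
    Representation F G (V ⧸ Submodule.span F {v}) :=
  ρ.quotient _ fun g => by
    rw [Submodule.span_le, Set.singleton_subset_iff, Submodule.comap_coe, Set.mem_preimage, hv]
    exact Submodule.mem_span_singleton_self v

theorem exists_eq_add_of_mem_ker_quotientSpanSingleton {v : V} (hv : ∀ g, ρ g v = v) {a : G}
    (ha : a ∈ (quotientSpanSingleton ρ hv).ker) (w : V) : ∃ c : F, ρ a w = w + c • v := by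
  have h1 : Submodule.Quotient.mk (p := Submodule.span F {v}) (ρ a w) = Submodule.Quotient.mk w :=
    LinearMap.congr_fun ha (Submodule.Quotient.mk w)
  obtain ⟨c, hc⟩ := Submodule.mem_span_singleton.1 ((Submodule.Quotient.eq _).1 h1)
  exact ⟨c, by rw [hc]; abel⟩

/-- A finite `p`-group with a faithful representation on a space `V` of dimension `n + 1` in
characteristic `p` is an extension of a group with a faithful representation on a quotient of `V`
of dimension `n` by a commutative group of exponent dividing `p`. -/
theorem exists_faithful_quotient (p : ℕ) [Fact p.Prime] [CharP F p] [Finite G] (hG : IsPGroup p G)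
    [Module.Finite F V] {n : ℕ} (hV : Module.finrank F V = n + 1) (hρ : Function.Injective ρ) :
    ∃ (S : Subgroup G) (_ : S.Normal) (L : Submodule F V) (τ : Representation F (G ⧸ S) (V ⧸ L)),
      Module.finrank F (V ⧸ L) = n ∧ Function.Injective τ ∧
        (∀ a ∈ S, ∀ b ∈ S, a * b = b * a) ∧ ∀ a ∈ S, a ^ p = 1 := by
  have : Nontrivial V := Module.nontrivial_of_finrank_pos (R := F) (by rw [hV]; exact n.succ_pos)
  obtain ⟨v, hv0, hv⟩ := exists_ne_zero_fixed_of_isPGroup p hG ρ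
  have hVL := (Submodule.span F {v}).finrank_quotient_add_finrank
  rw [finrank_span_singleton hv0, hV] at hVL
  exact ⟨(quotientSpanSingleton ρ hv).ker, inferInstance, Submodule.span F {v},
    QuotientGroup.lift _ (quotientSpanSingleton ρ hv) le_rfl, Nat.add_right_cancel hVL,
    QuotientGroup.lift_ker_injective (quotientSpanSingleton ρ hv),
    fun a ha b hb => commute_of_forall_exists_eq_add hρ hv
      (exists_eq_add_of_mem_ker_quotientSpanSingleton hv ha)
      (exists_eq_add_of_mem_ker_quotientSpanSingleton hv hb),
    fun a ha => pow_eq_one_of_forall_exists_eq_add p hρ hv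
      (exists_eq_add_of_mem_ker_quotientSpanSingleton hv ha)⟩

end Representation

/-! ### Induction on the dimension -/

namespace groupHomology

open CategoryTheory Rep Finsupp Representation

variable {k : Type u} [CommRing k]

theorem isKilledBy_prime_of_commute_of_pow_eq_one (p : ℕ) [Fact p.Prime] {G : Type u}
    [hgr : Group G] [Finite G] (hcomm : ∀ g h : G, g * h = h * g) (hG : ∀ g : G, g ^ p = 1)
    (A : Rep.{u} k G) (χ : G →* ℤˣ) (hχ : ∀ g a, A.ρ g a = (χ g : ℤ) • a) (i : ℕ) :
    IsKilledBy A (i + 1) p :=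
  @isKilledBy_prime_of_pow_eq_one k _ p _ G { hgr with mul_comm := hcomm } _ hG A χ hχ i

theorem quotientToCoinvariants_ρ_apply {G : Type u} [Group G] (S : Subgroup G) [S.Normal]
    (A : Rep.{u} k G) (χ : G →* ℤˣ) (hχ : ∀ g a, A.ρ g a = (χ g : ℤ) • a) (hS : S ≤ χ.ker)
    (g : G ⧸ S) (a : quotientToCoinvariants A S) :
    (quotientToCoinvariants A S).ρ g a = (QuotientGroup.lift S χ hS g : ℤ) • a := by
  induction g using QuotientGroup.induction_on with | H g =>
  induction a using Coinvariants.induction_on with | h a =>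
  change Coinvariants.mk _ (A.ρ g a) = (χ g : ℤ) • Coinvariants.mk _ a
  rw [hχ, map_zsmul]

theorem two_smul_quotientToCoinvariants {G : Type u} [Group G] (S : Subgroup G) [S.Normal]
    (A : Rep.{u} k G) (χ : G →* ℤˣ) (hχ : ∀ g a, A.ρ g a = (χ g : ℤ) • a) {g : G} (hg : g ∈ S)
    (hgχ : χ g = -1) (a : quotientToCoinvariants A S) : 2 • a = 0 := by
  induction a using Coinvariants.induction_on with | h a =>
  have h2 := Coinvariants.mk_self_apply (A.ρ.comp S.subtype) ⟨g, hg⟩ a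
  have h3 : (A.ρ.comp S.subtype) ⟨g, hg⟩ a = -a := by
    refine (hχ g a).trans ?_
    simp [hgχ]
  rw [h3, map_neg, neg_eq_iff_add_eq_zero] at h2
  rw [two_nsmul]
  exact h2

theorem eq_two_of_pow_eq_one_of_eq_neg_one {p : ℕ} (hp : p.Prime) {G : Type*} [Group G]
    (χ : G →* ℤˣ) {g : G} (hg : g ^ p = 1) (hgχ : χ g = -1) : p = 2 := by
  by_contra hne
  have h1 := congrArg χ hg
  rw [map_pow, hgχ, map_one, (hp.odd_of_ne_two hne).neg_one_pow] at h1
  exact absurd h1 (by decide)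

theorem isKilledBy_of_faithful {F : Type*} [Field F] (p : ℕ) [hp : Fact p.Prime] [CharP F p]
    (m : ℕ) {G : Type u} [Group G] [Finite G] (hG : IsPGroup p G) {V : Type v} [AddCommGroup V]
    [Module F V] [Module.Finite F V] (hV : Module.finrank F V = m + 2)
    (ρ : Representation F G V) (hρ : Function.Injective ρ) (A : Rep.{u} k G) (χ : G →* ℤˣ)
    (hχ : ∀ g a, A.ρ g a = (χ g : ℤ) • a) (s : ℕ) :
    IsKilledBy A (s + 1) (p ^ (1 + (s + 1) * m)) := by
  induction m generalizing G V with
  | zero =>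
    obtain ⟨S, _, L, τ, hL, hτ, hcomm, hpow⟩ := exists_faithful_quotient p hG hV hρ
    have := subsingleton_of_isPGroup_of_finrank_le_one p (hG.to_quotient S) (by lia) hτ
    have hST (g : G) : g ∈ S := (QuotientGroup.eq_one_iff g).1 (Subsingleton.elim _ _)
    rw [mul_zero, add_zero, pow_one]
    exact isKilledBy_prime_of_commute_of_pow_eq_one p
      (fun g h => hcomm g (hST g) h (hST h)) (fun g => hpow g (hST g)) A χ hχ s
  | succ m ih =>
    obtain ⟨S, _, L, τ, hL, hτ, hcomm, hpow⟩ := exists_faithful_quotient p hG hV hρ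
    have hkS (j : ℕ) : IsKilledBy (res S.subtype A) (j + 1) p :=
      isKilledBy_prime_of_commute_of_pow_eq_one p
        (fun g h => Subtype.ext (hcomm g g.2 h h.2)) (fun g => Subtype.ext (hpow g g.2)) _
        (χ.comp S.subtype) (fun g a => hχ g a) j
    by_cases hχS : S ≤ χ.ker
    · have h1 := ih (hG.to_quotient S) hL τ hτ (quotientToCoinvariants A S)
        (QuotientGroup.lift S χ hχS) (quotientToCoinvariants_ρ_apply S A χ hχ hχS)
      refine (IsKilledBy.of_normal S s A (fun j _ => hkS j) h1).of_dvd (dvd_of_eq ?_)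
      ring
    · obtain ⟨a, haS, ha⟩ := SetLike.not_le_iff_exists.1 hχS
      have ha1 : χ a = -1 := (Int.units_eq_one_or _).resolve_left ha
      obtain rfl := eq_two_of_pow_eq_one_of_eq_neg_one hp.out χ (hpow a haS) ha1
      -- No induction hypothesis is needed here: the bound `2 ^ (s + 1) * 2` divides the target
      -- since `s + 2 ≤ 1 + (s + 1) * (m + 1)`.
      have h1 : IsKilledBy (quotientToCoinvariants A S) (s + 1) 2 :=
        isKilledBy_of_forall_smul_eq_zero (two_smul_quotientToCoinvariants S A χ hχ haS ha1) _
      refine (IsKilledBy.of_normal S s A (fun j _ => hkS j) h1).of_dvd ?_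
      rw [← pow_succ]
      exact pow_dvd_pow _ (by nlinarith)

end groupHomology

theorem mainTheorem6 {F : Type u} [Field F] (p : ℕ) [Fact p.Prime] [CharP F p]
    (d : ℕ) (hd : 1 ≤ d) (H : Subgroup (GL (Fin d) F)) [Finite H] (hH : IsPGroup p H)
    (χ : H →* ℤˣ) (s : ℕ) (hs : 1 ≤ s) (x : characterHomology χ s) :
    p ^ (1 + (s : ℤ) * ((d : ℤ) - 2)).toNat • x = 0 := by
  obtain ⟨s, rfl⟩ := Nat.exists_eq_add_of_le' hs
  let ρ : Representation F H (Fin d → F) :=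
    (Units.coeHom _).comp (Matrix.GeneralLinearGroup.toLin.toMonoidHom.comp H.subtype)
  have hρ : Function.Injective ρ := Units.val_injective.comp
    (Matrix.GeneralLinearGroup.toLin.injective.comp Subtype.val_injective)
  obtain rfl | ⟨m, rfl⟩ : d = 1 ∨ ∃ m, d = m + 2 := by
    rcases Nat.exists_eq_add_of_le' hd with ⟨_ | m, rfl⟩
    · exact Or.inl rfl
    · exact Or.inr ⟨m, rfl⟩
  -- For `d = 1` the exponent truncates to 0, so vanishing itself is needed; it holds because `H` is
  -- trivial.
  · have := Representation.subsingleton_of_isPGroup_of_finrank_le_one p hH (by simp) hρ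
    exact groupHomology.isKilledBy_of_isZero (isZero_groupHomology_succ_of_subsingleton _ s) _ x
  · have h := groupHomology.isKilledBy_of_faithful p m hH (by simp) ρ hρ
      (Rep.of (characterRepresentation (ULift.{u} ℤ) χ)) χ
      (fun g a => (zsmul_eq_mul a ((χ g : ℤˣ) : ℤ)).symm) s x
    have he : (1 + ((s + 1 : ℕ) : ℤ) * (((m + 2 : ℕ) : ℤ) - 2)).toNat = 1 + (s + 1) * m := by
      rw [show (1 + ((s + 1 : ℕ) : ℤ) * (((m + 2 : ℕ) : ℤ) - 2)) = ((1 + (s + 1) * m : ℕ) : ℤ) by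
        push_cast; ring, Int.toNat_natCast]
    rwa [he]
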